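/- Let $\overline{\mathbb{Q}}$ be an algebraic closure of $\mathbb{Q}$, and let $\Gamma\subseteq\overline{\mathbb{Q}}^*$ be a subgroup of finite rank, i.e. the number of elements in a $\mathbb{Z}$-linearly independent (multiplicatively independent) subset of $\Gamma$ is bounded. Let $\Gamma_{\rm div}=\{\gamma\in\overline{\mathbb{Q}}^* : \gamma^n\in\Gamma \text{ for some integer } n\geq 1\}$ be the divisible hull of $\Gamma$. Then for every finite extension $L\subseteq\overline{\mathbb{Q}}$ of the field $\mathbb{Q}(\Gamma_{\rm div})$, the group $L^*/\Gamma_{\rm div}$ is free abelian. -/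

import Mathlib

/-- The divisible hull `Γ_div = {g ∈ G | g ^ n ∈ Γ for some n ≥ 1}` of a subgroup `Γ` of an abelian
group `G` (written multiplicatively). -/
def divHull {G : Type*} [CommGroup G] (Γ : Subgroup G) : Subgroup G where
  carrier := {g | ∃ n : ℕ, 0 < n ∧ g ^ n ∈ Γ}
  one_mem' := ⟨1, Nat.one_pos, by simp [Γ.one_mem]⟩
  mul_mem' := by
    rintro a b ⟨m, hm, ha⟩ ⟨n, hn, hb⟩
    refine ⟨m * n, Nat.mul_pos hm hn, ?_⟩
    rw [mul_pow, pow_mul, mul_comm m n, pow_mul b]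
    exact Γ.mul_mem (Γ.pow_mem ha n) (Γ.pow_mem hb m)
  inv_mem' := by
    rintro a ⟨n, hn, ha⟩
    exact ⟨n, hn, by rw [inv_pow]; exact Γ.inv_mem ha⟩

/-- A (multiplicative) abelian group has finite rank if the number of its elements that are
linearly independent over `ℤ` is bounded, i.e. its rank as a `ℤ`-module is finite. -/
def HasFiniteRank (A : Type*) [CommGroup A] : Prop :=
  Module.rank ℤ (Additive A) < Cardinal.aleph0

/-- A (multiplicative) abelian group is free abelian if it has a `ℤ`-basis. -/
def IsFreeAbelian (A : Type*) [CommGroup A] : Prop :=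
  Module.Free ℤ (Additive A)

/-- The subfield `ℚ(Γ_div)` of the algebraic closure of `ℚ`. -/
noncomputable def fieldOfDivHull (Γ : Subgroup (AlgebraicClosure ℚ)ˣ) :
    IntermediateField ℚ (AlgebraicClosure ℚ) :=
  IntermediateField.adjoin ℚ
    ((fun u : (AlgebraicClosure ℚ)ˣ => (u : AlgebraicClosure ℚ)) '' (divHull Γ : Set _))

/-- For a field `L` between `ℚ(Γ_div)` and the algebraic closure of `ℚ`: the group `Γ_div`, as a
subgroup of `Lˣ`. (All elements of `Γ_div` lie in `L`.) -/
noncomputable def divHullIn (Γ : Subgroup (AlgebraicClosure ℚ)ˣ)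
    (L : IntermediateField (fieldOfDivHull Γ) (AlgebraicClosure ℚ)) : Subgroup Lˣ :=
  (divHull Γ).comap (Units.map (algebraMap L (AlgebraicClosure ℚ) : L →* AlgebraicClosure ℚ))

/-! By Pontryagin's criterion (`Module.free_of_countable_of_saturation_fg`) it suffices that the
saturation of a finitely generated subgroup of $L^*/\Gamma_{\rm div}$ is finitely generated. Choose
a number field $K$ with $L\subseteq K[\Gamma_{\rm div}]$ and a finitely generated $H\le K^*$
covering the given generators and having $\Gamma_{\rm div}$ in its divisible hull. The saturation of
$H$ in $K^*$ is finitely generated by the unit theorem (`NumberField.saturation_fg`).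

If $x\in L^*$ has a power in $H\Gamma_{\rm div}$, divisibility allows $x^n\in H$ after changing $x$
by $\Gamma_{\rm div}$. Independence of characters then moves $x$ into $K(\mu_\infty)$
(`exists_div_fixed_of_mem_span`). As $K(\mu_\infty)/K$ is abelian, $x^w\in K^*\mu_\infty$, where $w$
is the number of roots of unity in $K$ (`exists_pow_mul_eq_of_fixed`). Since $w$ does not depend on
$x$, multiplication by $w$ embeds the saturation into a finitely generated group. -/

namespace Submodule

/-! ### Saturations and Pontryagin's criterion -/

variable {R A : Type*} [CommRing R] [IsDomain R] [AddCommGroup A] [Module R A]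

/-- The elements of a module having a nonzero multiple in a given submodule. -/
def saturation (N : Submodule R A) : Submodule R A where
  carrier := {x | ∃ r : R, r ≠ 0 ∧ r • x ∈ N}
  zero_mem' := ⟨1, one_ne_zero, by simp⟩
  add_mem' := by
    rintro x y ⟨r, hr, hx⟩ ⟨s, hs, hy⟩
    refine ⟨r * s, mul_ne_zero hr hs, ?_⟩
    rw [smul_add]
    refine N.add_mem ?_ ?_
    · rw [mul_comm, mul_smul]; exact N.smul_mem s hx
    · rw [mul_smul]; exact N.smul_mem r hy
  smul_mem' := by
    rintro c x ⟨r, hr, hx⟩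
    exact ⟨r, hr, by rw [smul_comm]; exact N.smul_mem c hx⟩

theorem mem_saturation {N : Submodule R A} {x : A} :
    x ∈ N.saturation ↔ ∃ r : R, r ≠ 0 ∧ r • x ∈ N := Iff.rfl

theorem le_saturation (N : Submodule R A) : N ≤ N.saturation :=
  fun x hx => ⟨1, one_ne_zero, by simpa using hx⟩

theorem saturation_mono {N P : Submodule R A} (h : N ≤ P) : N.saturation ≤ P.saturation :=
  fun _ ⟨r, hr, hx⟩ => ⟨r, hr, h hx⟩

theorem saturation_saturation (N : Submodule R A) : N.saturation.saturation = N.saturation := by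
  refine le_antisymm ?_ (le_saturation _)
  rintro x ⟨r, hr, s, hs, hx⟩
  exact ⟨s * r, mul_ne_zero hs hr, by rwa [mul_smul]⟩

instance isTorsionFree_quotient_saturation (N : Submodule R A) :
    Module.IsTorsionFree R (A ⧸ N.saturation) := by
  refine Module.IsTorsionFree.of_smul_eq_zero fun r x h => ?_
  obtain ⟨x, rfl⟩ := mkQ_surjective _ x
  by_cases hr : r = 0
  · exact Or.inl hr
  · right
    rw [← map_smul, mkQ_apply, Quotient.mk_eq_zero] at h
    rw [mkQ_apply, Quotient.mk_eq_zero, ← saturation_saturation]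
    exact ⟨r, hr, h⟩

variable [IsPrincipalIdealRing R]

/-- The image of `Q` modulo the saturation is finite and torsion-free over a PID, hence free; lifts
of a basis of it complete `s`. -/
theorem exists_linearIndepOn_span_eq_of_saturation_le {N Q : Submodule R A}
    (hNQ : N.saturation ≤ Q) (hQ : Q.FG) {s : Set A} (hs : LinearIndepOn R id s)
    (hspan : span R s = N.saturation) :
    ∃ t, s ⊆ t ∧ LinearIndepOn R id t ∧ span R t = Q := by
  have : Module.Finite R (Q.map N.saturation.mkQ) := Module.Finite.iff_fg.2 (hQ.map _)
  let b := Module.Free.chooseBasis R (Q.map N.saturation.mkQ)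
  have hb (i) : ∃ c ∈ Q, N.saturation.mkQ c = b i := (b i).2
  choose c hcQ hc using hb
  have h5 : (fun i => (b i : A ⧸ N.saturation)) = N.saturation.mkQ ∘ c := by
    ext i; exact (hc i).symm
  have hcind : LinearIndependent R (Submodule.Quotient.mk (p := N.saturation) ∘ c) := by
    have := b.linearIndependent.map' (Q.map N.saturation.mkQ).subtype (ker_subtype _)
    change LinearIndependent R fun i => (b i : A ⧸ N.saturation) at this
    rw [h5] at this
    exact this
  let f : s → N.saturation := fun x => ⟨x, hspan ▸ subset_span x.2⟩
  have hf : LinearIndependent R f :=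
    LinearIndependent.of_comp N.saturation.subtype hs
  have key := hf.sumElim_of_quotient c hcind
  refine ⟨Set.range (Sum.elim (fun i => (f i : A)) c), ?_, key.linearIndepOn_id, ?_⟩
  · intro x hx
    exact ⟨Sum.inl ⟨x, hx⟩, rfl⟩
  · have hr : Set.range (Sum.elim (fun i => (f i : A)) c) = s ∪ Set.range c := by
      rw [Set.Sum.elim_range]
      congr 1
      exact Subtype.range_coe
    rw [hr, span_union, hspan]
    refine le_antisymm (sup_le hNQ (span_le.2 (by rintro _ ⟨i, rfl⟩; exact hcQ i))) ?_
    intro x hx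
    have h1 : N.saturation.mkQ x ∈ span R (Set.range fun i => (b i : A ⧸ N.saturation)) := by
      have h2 := b.span_eq
      have h3 := congrArg (Submodule.map (Q.map N.saturation.mkQ).subtype) h2
      rw [map_span, ← Set.range_comp, map_top, range_subtype] at h3
      have h4 : N.saturation.mkQ x ∈ Q.map N.saturation.mkQ := mem_map_of_mem hx
      rw [← h3] at h4
      exact h4
    rw [h5, Set.range_comp, ← map_span, ← mem_comap, comap_map_eq, ker_mkQ, sup_comm] at h1
    exact h1

/-- Pontryagin's criterion: a countable module over a principal ideal domain is free
as soon as it is torsion-free and the saturations of its finitely generated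
submodules are finitely generated. -/
theorem _root_.Module.free_of_countable_of_saturation_fg [Countable A] [Module.IsTorsionFree R A]
    (h : ∀ N : Submodule R A, N.FG → N.saturation.FG) : Module.Free R A := by
  obtain ⟨e, he⟩ := exists_surjective_nat A
  let N : ℕ → Submodule R A := fun n => span R (e '' Set.Iio n)
  have hN (n) : (N n).FG := fg_span ((Set.finite_Iio n).image e)
  have hmono (n) : (N n).saturation ≤ (N (n + 1)).saturation :=
    saturation_mono (span_mono (Set.image_mono (Set.Iio_subset_Iio n.le_succ)))
  have step (n : ℕ) (s : {s : Set A // LinearIndepOn R id s ∧ span R s = (N n).saturation}) :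
      ∃ t : {s : Set A // LinearIndepOn R id s ∧ span R s = (N (n + 1)).saturation},
        s.1 ⊆ t.1 := by
    obtain ⟨t, hst, ht⟩ := exists_linearIndepOn_span_eq_of_saturation_le (hmono n)
      (h _ (hN _)) s.2.1 s.2.2
    exact ⟨⟨t, ht⟩, hst⟩
  have base : LinearIndepOn R id (∅ : Set A) ∧ span R (∅ : Set A) = (N 0).saturation := by
    refine ⟨linearIndepOn_empty R id, ?_⟩
    rw [span_empty]
    refine (le_antisymm ?_ bot_le).symm
    rintro x ⟨r, hr, hx⟩
    have : r • x = 0 := by simpa [N] using hx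
    exact (smul_eq_zero.1 this).resolve_left hr
  -- The bases are chosen nested, so that their union is still independent.
  choose next hnext using step
  let s (n : ℕ) : {s : Set A // LinearIndepOn R id s ∧ span R s = (N n).saturation} :=
    Nat.rec ⟨∅, base⟩ next n
  have hs : Monotone fun n => (s n).1 := monotone_nat_of_le_succ fun n => hnext n (s n)
  have hli := linearIndepOn_iUnion_of_directed hs.directed_le fun n => (s n).2.1
  refine Module.Free.of_basis (Module.Basis.mk hli fun x _ => ?_)
  obtain ⟨n, rfl⟩ := he x
  have hx : e n ∈ span R (s (n + 1)).1 := by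
    rw [(s (n + 1)).2.2]
    exact le_saturation _ (subset_span ⟨n, n.lt_succ_self, rfl⟩)
  refine span_mono ?_ hx
  rw [show (fun x : ↥(⋃ n, (s n).1) => id x.1) = Subtype.val from rfl, Subtype.range_coe]
  exact Set.subset_iUnion (fun n => (s n).1) (n + 1)

end Submodule

/-! ### Saturation in the multiplicative group of a number field -/

open IsDedekindDomain NumberField in
/-- The saturation of a finitely generated group of nonzero elements of a number field is
finitely generated. -/
theorem NumberField.saturation_fg {K : Type*} [Field K] [NumberField K]
    {N : Submodule ℤ (Additive Kˣ)} (hN : N.FG) : N.saturation.FG := by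
  obtain ⟨g, rfl⟩ := hN
  let v (p : HeightOneSpectrum (𝓞 K)) : Additive Kˣ →ₗ[ℤ] ℤ :=
    (MonoidHom.toAdditiveLeft p.valuationOfNeZero).toIntLinearMap
  have hv (p) (x : Additive Kˣ) : v p x = 0 ↔ p.valuation K (x.toMul : K) = 1 := by
    rw [← HeightOneSpectrum.valuationOfNeZero_eq, ← WithZero.coe_one, WithZero.coe_inj]
    exact Iff.rfl
  have hfin (x : Additive Kˣ) : {p | v p x ≠ 0}.Finite := by
    refine ((HeightOneSpectrum.Support.finite (𝓞 K) (x.toMul : K)).union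
      (HeightOneSpectrum.Support.finite (𝓞 K) ((x.toMul : K)⁻¹))).subset fun p hp => ?_
    rw [Set.mem_ofPred_eq, ne_eq, hv] at hp
    rcases lt_or_gt_of_ne hp with h | h
    · right
      simp only [HeightOneSpectrum.Support, Set.mem_ofPred_eq, map_inv₀]
      exact (one_lt_inv₀ (zero_lt_iff.2 ((Valuation.ne_zero_iff _).2 x.toMul.ne_zero))).2 h
    · exact Or.inl h
  let S : Set (HeightOneSpectrum (𝓞 K)) := ⋃ x ∈ g, {p | v p x ≠ 0}
  have hS : S.Finite := g.finite_toSet.biUnion fun x _ => hfin x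
  have := hS.fintype
  let f : Additive Kˣ →ₗ[ℤ] S → ℤ := LinearMap.pi fun p => v p
  -- Outside `S` all valuations vanish on the saturation, so the part killed by `f` consists of
  -- units of `𝓞 K`, a finitely generated group by Dirichlet.
  refine Submodule.fg_of_fg_map_of_fg_inf_ker f (IsNoetherian.noetherian _) ?_
  let u : Additive (𝓞 K)ˣ →ₗ[ℤ] Additive Kˣ :=
    (MonoidHom.toAdditive (Units.map (algebraMap (𝓞 K) K : 𝓞 K →* K))).toIntLinearMap
  have hu : IsNoetherian ℤ (LinearMap.range u) := inferInstance
  refine Submodule.FG.of_le_of_isNoetherian (T := LinearMap.range u) ?_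
  rintro x ⟨⟨r, hr, hx⟩, hker⟩
  have hall (p) : v p x = 0 := by
    by_cases hp : p ∈ S
    · exact congrFun (LinearMap.mem_ker.1 hker) ⟨p, hp⟩
    · have : Submodule.span ℤ (g : Set (Additive Kˣ)) ≤ LinearMap.ker (v p) := by
        refine Submodule.span_le.2 fun y hy => ?_
        by_contra hy'
        exact hp (Set.mem_biUnion hy hy')
      have h0 := LinearMap.mem_ker.1 (this hx)
      rw [map_smul, smul_eq_zero] at h0
      exact h0.resolve_left hr
  have hint (y : Additive Kˣ) (hy : ∀ p, v p y = 0) : ∃ a : 𝓞 K, (a : K) = y.toMul :=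
    HeightOneSpectrum.mem_integers_of_valuation_le_one K _ fun p => ((hv p y).1 (hy p)).le
  obtain ⟨a, ha⟩ := hint x hall
  obtain ⟨b, hb⟩ := hint (-x) fun p => by rw [map_neg, hall, neg_zero]
  have hab : a * b = 1 := by
    apply RingOfIntegers.ext
    change (a : K) * (b : K) = 1
    rw [ha, hb]
    simp
  exact ⟨Additive.ofMul ⟨a, b, hab, by rw [mul_comm, hab]⟩, Additive.toMul.injective (Units.ext ha)⟩

/-! ### Kummer theory over the roots of unity -/

/-- Let `D` be a group of elements with a power in `K`. An element of `K[D]` with a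
power in `K` is, up to an element of `D`, fixed by every automorphism over `K` that fixes all the
roots of unity. -/
theorem exists_div_fixed_of_mem_span {K Ω : Type*} [Field K] [Field Ω] [Algebra K Ω]
    (D : Subgroup Ωˣ) (hD : ∀ d ∈ D, ∃ n : ℕ, 0 < n ∧ (d : Ω) ^ n ∈ (algebraMap K Ω).range)
    {x : Ωˣ} (hx : (x : Ω) ∈ Algebra.adjoin K (Units.val '' (D : Set Ωˣ)))
    {n : ℕ} (hn : 0 < n) (hxn : (x : Ω) ^ n ∈ (algebraMap K Ω).range) :
    ∃ d ∈ D, ∀ σ : Ω ≃ₐ[K] Ω, (∀ ζ : Ω, ∀ k : ℕ, 0 < k → ζ ^ k = 1 → σ ζ = ζ) →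
      σ ((x / d : Ωˣ) : Ω) = ((x / d : Ωˣ) : Ω) := by
  have hspan : (x : Ω) ∈ Submodule.span K (Units.val '' (D : Set Ωˣ)) := by
    have hcl : Submonoid.closure (Units.val '' (D : Set Ωˣ)) =
        D.toSubmonoid.map (Units.coeHom Ω) :=
      Submonoid.closure_eq (D.toSubmonoid.map (Units.coeHom Ω))
    rw [← Subalgebra.mem_toSubmodule, Algebra.adjoin_eq_span, hcl] at hx
    exact hx
  let G : Subgroup (Ω ≃ₐ[K] Ω) :=
    { carrier := {σ | ∀ ζ : Ω, ∀ k : ℕ, 0 < k → ζ ^ k = 1 → σ ζ = ζ}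
      one_mem' := fun _ _ _ _ => rfl
      mul_mem' := fun {σ τ} hσ hτ ζ k hk h => by
        rw [AlgEquiv.mul_apply, hτ ζ k hk h, hσ ζ k hk h]
      inv_mem' := fun {σ} hσ ζ k hk h => by
        rw [AlgEquiv.aut_inv, AlgEquiv.symm_apply_eq, hσ ζ k hk h] }
  have hroot (σ : Ω ≃ₐ[K] Ω) {z : Ωˣ} {k : ℕ} (hz : (z : Ω) ^ k ∈ (algebraMap K Ω).range) :
      (σ z * (z : Ω)⁻¹) ^ k = 1 := by
    obtain ⟨c, hc⟩ := hz
    rw [mul_pow, ← map_pow, inv_pow, ← hc, AlgEquiv.commutes, hc]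
    exact mul_inv_cancel₀ (pow_ne_zero _ z.ne_zero)
  -- The cocycle `σ z / z` takes values in roots of unity, which `G` fixes, so it is a character.
  have hchar (z : Ωˣ) (hz : ∃ k : ℕ, 0 < k ∧ (z : Ω) ^ k ∈ (algebraMap K Ω).range) :
      ∃ χ : G →* Ω, ∀ σ : G, σ.1 z = χ σ * z := by
    obtain ⟨k, hk, hz⟩ := hz
    refine ⟨⟨⟨fun σ => σ.1 z * (z : Ω)⁻¹, by simp⟩, fun σ τ => ?_⟩, fun σ => by simp⟩
    have h1 := σ.2 _ k hk (hroot τ.1 hz)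
    rw [map_mul, map_inv₀] at h1
    have h2 : σ.1 (z : Ω) ≠ 0 := by simp
    simp only [Subgroup.coe_mul, AlgEquiv.mul_apply]
    rw [mul_comm (σ.1 _ * _), ← h1]
    field_simp
  obtain ⟨χ, hχ⟩ := hchar x ⟨n, hn, hxn⟩
  choose! ψ hψ using fun d hd => hchar d (hD d hd)
  suffices ∃ d ∈ D, ψ d = χ by
    obtain ⟨d, hd, h⟩ := this
    refine ⟨d, hd, fun σ hσ => ?_⟩
    have h1 := hχ ⟨σ, hσ⟩
    have h2 := hψ d hd ⟨σ, hσ⟩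
    have h3 : χ ⟨σ, hσ⟩ ≠ 0 := fun h0 => by
      rw [h0, zero_mul] at h1
      simp at h1
    rw [h] at h2
    simp only at h1 h2
    rw [Units.val_div_eq_div_val, map_div₀, h1, h2, mul_div_mul_left _ _ h3]
  by_contra! hne
  have hind := linearIndependent_monoidHom G Ω
  -- The orbit map of an element of `K[D]` is a combination of the characters `ψ d`, that of `x` is
  -- a multiple of `χ`; Dedekind independence forces `χ` to be some `ψ d`.
  have hmem {z : Ω} (hz : z ∈ Submodule.span K (Units.val '' (D : Set Ωˣ))) :
      (fun σ : G => σ.1 z) ∈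
        Submodule.span Ω ((fun f : G →* Ω => (f : G → Ω)) '' (ψ '' D)) := by
    induction hz using Submodule.span_induction with
    | mem y hy =>
      obtain ⟨d, hd, rfl⟩ := hy
      have : (fun σ : G => σ.1 (d : Ω)) = (d : Ω) • (ψ d : G → Ω) := by
        ext σ
        rw [hψ d hd, mul_comm]
        rfl
      rw [this]
      exact Submodule.smul_mem _ _ (Submodule.subset_span ⟨_, ⟨d, hd, rfl⟩, rfl⟩)
    | zero =>
      have : (fun σ : G => σ.1 (0 : Ω)) = 0 := by
        ext σ
        exact map_zero σ.1
      rw [this]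
      exact Submodule.zero_mem _
    | add y z _ _ hy hz =>
      convert Submodule.add_mem _ hy hz using 1
      ext σ
      exact map_add σ.1 y z
    | smul c y _ hy =>
      have := Submodule.smul_mem _ (algebraMap K Ω c) hy
      convert this using 1
      ext σ
      simp [Algebra.smul_def]
  have hχx : (fun σ : G => σ.1 (x : Ω)) = (x : Ω) • (χ : G → Ω) := by
    ext σ
    rw [hχ, mul_comm]
    rfl
  have hmemx := hmem hspan
  rw [hχx, Submodule.smul_mem_iff _ x.ne_zero] at hmemx
  refine hind.notMem_span_image (s := ψ '' D) (x := χ) ?_ hmemx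
  rintro ⟨d, hd, h⟩
  exact hne d hd h

/-- If `K` contains only finitely many roots of unity, then every radical over `K` lying in
the field generated over `K` by all the roots of unity has a bounded power which is the product of
an element of `K` and a root of unity. -/
theorem exists_pow_mul_eq_of_fixed {K Ω : Type*} [Field K] [Field Ω] [Algebra K Ω]
    [IsGalois K Ω] [IsSepClosed Ω] [CharZero Ω]
    {w : ℕ} (hw : ∀ ζ : K, ∀ k : ℕ, 0 < k → ζ ^ k = 1 → ζ ^ w = 1)
    {y : Ωˣ} {n : ℕ} (hn : 0 < n) (hyn : (y : Ω) ^ n ∈ (algebraMap K Ω).range)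
    (hy : ∀ σ : Ω ≃ₐ[K] Ω, (∀ ζ : Ω, ∀ k : ℕ, 0 < k → ζ ^ k = 1 → σ ζ = ζ) → σ y = y) :
    ∃ (b : Kˣ) (ζ : Ωˣ) (k : ℕ), 0 < k ∧ ζ ^ k = 1 ∧
      y ^ w = Units.map (algebraMap K Ω : K →* Ω) b * ζ := by
  have hprim (k : ℕ) (hk : 0 < k) : ∃ η : Ω, IsPrimitiveRoot η k := by
    have : NeZero k := ⟨hk.ne'⟩
    have : NeZero (k : Ω) := ⟨Nat.cast_ne_zero.2 hk.ne'⟩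
    exact HasEnoughRootsOfUnity.exists_primitiveRoot Ω k
  have hact (τ : Ω ≃ₐ[K] Ω) (k : ℕ) (hk : 0 < k) : ∃ a : ℕ, ∀ ζ : Ω, ζ ^ k = 1 → τ ζ = ζ ^ a := by
    have : NeZero k := ⟨hk.ne'⟩
    obtain ⟨η, hη⟩ := hprim k hk
    obtain ⟨a, -, ha⟩ := hη.eq_pow_of_pow_eq_one (ξ := τ η) (by rw [← map_pow, hη.1, map_one])
    refine ⟨a, fun ζ hζ => ?_⟩
    obtain ⟨i, -, rfl⟩ := hη.eq_pow_of_pow_eq_one hζ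
    rw [map_pow, ← ha, ← pow_mul, ← pow_mul, mul_comm]
  -- Automorphisms act on roots of unity by powers, so commutators fix them all, and hence fix `y`.
  have hcomm (σ τ : Ω ≃ₐ[K] Ω) : σ (τ y) = τ (σ y) := by
    have h := hy ((τ * σ)⁻¹ * (σ * τ)) fun ζ k hk hζ => by
      obtain ⟨a, ha⟩ := hact σ k hk
      obtain ⟨b, hb⟩ := hact τ k hk
      rw [AlgEquiv.mul_apply, AlgEquiv.aut_inv, AlgEquiv.symm_apply_eq, AlgEquiv.mul_apply,
        AlgEquiv.mul_apply, ha ζ hζ, hb ζ hζ, map_pow, map_pow, ha ζ hζ, hb ζ hζ, ← pow_mul,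
        ← pow_mul, mul_comm]
    rwa [AlgEquiv.mul_apply, AlgEquiv.aut_inv, AlgEquiv.symm_apply_eq] at h
  let i : Kˣ →* Ωˣ := Units.map (algebraMap K Ω : K →* Ω)
  let P : Subgroup Ωˣ := i.range ⊔ CommGroup.torsion Ωˣ
  have hP {z : Ωˣ} : z ∈ P ↔ ∃ (b : Kˣ) (ζ : Ωˣ) (k : ℕ), 0 < k ∧ ζ ^ k = 1 ∧ z = i b * ζ := by
    rw [Subgroup.mem_sup]
    simp only [CommGroup.mem_torsion, isOfFinOrder_iff_pow_eq_one]
    constructor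
    · rintro ⟨_, ⟨b, rfl⟩, ζ, ⟨k, hk, h⟩, rfl⟩
      exact ⟨b, ζ, k, hk, h, rfl⟩
    · rintro ⟨b, ζ, k, hk, h, rfl⟩
      exact ⟨_, ⟨b, rfl⟩, ζ, ⟨k, hk, h⟩, rfl⟩
  have hmemP {z ζ : Ωˣ} (hz : (z : Ω) ∈ (algebraMap K Ω).range) {k : ℕ} (hk : 0 < k)
      (hζ : ζ ^ k = 1) : z * ζ ∈ P := by
    obtain ⟨c, hc⟩ := hz
    have hc0 : c ≠ 0 := by
      rintro rfl
      exact z.ne_zero (by rw [← hc, map_zero])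
    exact hP.2 ⟨Units.mk0 c hc0, ζ, k, hk, hζ, by congr 1; exact Units.ext hc.symm⟩
  -- The exponents `m` with `y ^ m` in `P` form `gℤ`; the aim is `g ∣ w`, reached by placing a
  -- primitive `g`-th root of unity in `K`.
  let T : AddSubgroup ℤ := (Subgroup.toAddSubgroup P).comap (zmultiplesHom _ (Additive.ofMul y))
  have hT (m : ℤ) : m ∈ T ↔ y ^ m ∈ P := Iff.rfl
  obtain ⟨g, hg⟩ := Int.subgroup_cyclic T
  rw [← AddSubgroup.zmultiples_eq_closure] at hg
  have hT' (m : ℤ) : m ∈ T ↔ g ∣ m := by rw [hg, Int.mem_zmultiples_iff]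
  have hgn : g ∣ n := by
    rw [← hT', hT, zpow_natCast, ← mul_one (y ^ n)]
    exact hmemP (by simpa using hyn) one_pos (one_pow 1)
  have hgn' : g.natAbs ∣ n := Int.natCast_dvd_natCast.1 (Int.natAbs_dvd.2 hgn)
  have hg0 : 0 < g.natAbs := Nat.pos_of_dvd_of_pos hgn' hn
  obtain ⟨ξ, hξ⟩ := hprim _ hg0
  have hξfix (τ : Ω ≃ₐ[K] Ω) : τ ξ = ξ := by
    obtain ⟨a, ha⟩ := hact τ n hn
    have hτ (σ : Ω ≃ₐ[K] Ω) : (σ y / (y : Ω)) ^ n = 1 := by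
      obtain ⟨c, hc⟩ := hyn
      rw [div_pow, ← map_pow, ← hc, AlgEquiv.commutes, hc]
      exact div_self (pow_ne_zero _ y.ne_zero)
    -- By commutation, `σ` multiplies both `y ^ a` and `τ y` by `(σ y / y) ^ a`.
    have hz : (y : Ω) ^ a / τ y ∈ (algebraMap K Ω).range := by
      refine (InfiniteGalois.mem_range_algebraMap_iff_fixed _).2 fun σ => ?_
      have h1 : σ y = (σ y / (y : Ω)) * y := (div_mul_cancel₀ _ y.ne_zero).symm
      have h2 : τ (σ y) = (σ y / (y : Ω)) ^ a * τ y := by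
        rw [← ha _ (hτ σ), ← map_mul, ← h1]
      have h3 : σ y / (y : Ω) ≠ 0 := by simp
      have h4 : σ y ^ a = (σ y / (y : Ω)) ^ a * y ^ a := by rw [← mul_pow, ← h1]
      rw [map_div₀, hcomm, h2, map_pow, h4, mul_div_mul_left _ _ (pow_ne_zero _ h3)]
    have hdvd : g ∣ (a : ℤ) - 1 := by
      rw [← hT', hT]
      let ty : Ωˣ := Units.map (τ : Ω →* Ω) y
      have h4 : y ^ ((a : ℤ) - 1) = (y ^ a / ty) * (ty / y) := by
        rw [zpow_sub_one, zpow_natCast, div_mul_div_cancel, div_eq_mul_inv]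
      rw [h4]
      refine hmemP ?_ hn ?_
      · simpa [ty] using hz
      · ext
        simpa [ty] using hτ τ
    have hξn : ξ ^ n = 1 := (hξ.pow_eq_one_iff_dvd _).2 hgn'
    rw [ha ξ hξn]
    have h5 : ξ ^ ((a : ℤ) - 1) = 1 := (hξ.zpow_eq_one_iff_dvd _).2 (Int.natAbs_dvd.2 hdvd)
    have h6 : ξ ≠ 0 := hξ.ne_zero hg0.ne'
    rw [zpow_sub_one₀ h6, zpow_natCast] at h5
    exact (mul_inv_eq_one₀ h6).1 h5
  obtain ⟨z, rfl⟩ := (InfiniteGalois.mem_range_algebraMap_iff_fixed ξ).2 hξfix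
  have hzw : z ^ w = 1 := hw z _ hg0 <| (algebraMap K Ω).injective <| by
    rw [map_pow, hξ.1, map_one]
  have hgw : g.natAbs ∣ w := hξ.2 _ (by rw [← map_pow, hzw, map_one])
  rw [← zpow_natCast]
  exact hP.1 ((hT _).1 ((hT' _).2 (Int.natAbs_dvd.1 (Int.natCast_dvd_natCast.2 hgw))))

/-- Let `D` be a divisible group containing the roots of unity, all of whose elements have a power
in a group `H` of elements of `K`. If an element of `K[D]` has a power in `HD`, then a bounded power
of it is, up to an element of `D`, an element of `K` with a power in `H`. -/
theorem exists_pow_div_mem_of_pow_mem {K Ω : Type*} [Field K] [Field Ω] [Algebra K Ω]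
    [IsGalois K Ω] [IsSepClosed Ω] [CharZero Ω]
    {w : ℕ} (hw : ∀ ζ : K, ∀ k : ℕ, 0 < k → ζ ^ k = 1 → ζ ^ w = 1)
    {D : Subgroup Ωˣ} (hdiv : ∀ d ∈ D, ∀ n : ℕ, 0 < n → ∃ e ∈ D, e ^ n = d)
    (hroots : ∀ ζ : Ωˣ, ∀ k : ℕ, 0 < k → ζ ^ k = 1 → ζ ∈ D)
    {H : Subgroup Kˣ}
    (hD : ∀ d ∈ D, ∃ n : ℕ, 0 < n ∧ d ^ n ∈ H.map (Units.map (algebraMap K Ω : K →* Ω)))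
    {x : Ωˣ} (hx : (x : Ω) ∈ Algebra.adjoin K (Units.val '' (D : Set Ωˣ)))
    {n : ℕ} (hn : 0 < n)
    (hxn : ∃ h ∈ H, x ^ n / Units.map (algebraMap K Ω : K →* Ω) h ∈ D) :
    ∃ b : Kˣ, (∃ m : ℕ, 0 < m ∧ b ^ m ∈ H) ∧
      x ^ w / Units.map (algebraMap K Ω : K →* Ω) b ∈ D := by
  set i : Kˣ →* Ωˣ := Units.map (algebraMap K Ω : K →* Ω) with hi
  have hinj : Function.Injective i := Units.map_injective (algebraMap K Ω).injective
  obtain ⟨h, hh, hxn⟩ := hxn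
  obtain ⟨e, he, hen⟩ := hdiv _ hxn n hn
  have hrange (z : Kˣ) {u : Ωˣ} {k : ℕ} (hz : i z = u ^ k) :
      (u : Ω) ^ k ∈ (algebraMap K Ω).range :=
    ⟨z, by rw [← Units.val_pow_eq_pow_val, ← hz]; rfl⟩
  have hxe : (x / e) ^ n = i h := by rw [div_pow, hen, div_div_cancel]
  have hxe' : ((x / e : Ωˣ) : Ω) ∈ Algebra.adjoin K (Units.val '' (D : Set Ωˣ)) := by
    rw [div_eq_mul_inv, Units.val_mul]
    exact mul_mem hx (Algebra.subset_adjoin ⟨_, inv_mem he, rfl⟩)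
  obtain ⟨d, hd, hfix⟩ := exists_div_fixed_of_mem_span D
    (fun d hd => by
      obtain ⟨m, hm, c, -, hc⟩ := hD d hd
      exact ⟨m, hm, hrange c hc⟩) hxe' hn (hrange h hxe.symm)
  obtain ⟨m, hm, c, -, hc⟩ := hD d hd
  have hpow : i (h ^ m / c ^ n) = (x / e / d) ^ (n * m) := by
    rw [map_div, map_pow, map_pow, hc, ← hxe, div_pow (x / e), ← pow_mul, ← pow_mul, mul_comm m n]
  obtain ⟨b, ζ, k, hk, hζ, hb⟩ :=
    exists_pow_mul_eq_of_fixed hw (Nat.mul_pos hn hm) (hrange _ hpow) hfix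
  rw [← hi] at hb
  have hb' : i b = (x / e) ^ w / (d ^ w * ζ) := by
    rw [← div_div, ← div_pow, hb, mul_div_cancel_right]
  have hdζ : d ^ w * ζ ∈ D := mul_mem (pow_mem hd w) (hroots ζ k hk hζ)
  refine ⟨b, ?_, ?_⟩
  -- Here `i b ^ n` is `i h ^ w` divided by an element of `D`, which itself has a power in the image
  -- of `H`.
  · obtain ⟨l, hl, a, ha, hal⟩ := hD _ (pow_mem hdζ n)
    refine ⟨n * l, Nat.mul_pos hn hl, ?_⟩
    have : b ^ (n * l) = h ^ (w * l) / a := hinj <| by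
      rw [map_div, map_pow, map_pow, hal, hb', ← hxe]
      simp only [div_pow, ← pow_mul, mul_comm, mul_left_comm]
    rw [this]
    exact div_mem (pow_mem hh _) ha
  · rw [hb', div_pow, div_div, div_div_cancel]
    exact mul_mem (pow_mem he w) hdζ

/-! ### Finite rank, divisible hulls and finite extensions -/

/-- Modulo the span of an independent set of maximal cardinality the rank is zero, finiteness
permitting cancellation of cardinals. -/
theorem exists_finset_pow_mem_closure_of_hasFiniteRank {A : Type*} [CommGroup A]
    (hA : HasFiniteRank A) :
    ∃ s : Finset A, ∀ x : A, ∃ n : ℕ, 0 < n ∧ x ^ n ∈ Subgroup.closure (s : Set A) := by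
  obtain ⟨s, hs, hind⟩ := exists_set_linearIndependent_of_isDomain ℤ (Additive A)
  have hfin : s.Finite := Cardinal.lt_aleph0_iff_set_finite.1 (hs ▸ hA)
  have h1 := rank_quotient_add_rank_of_isDomain (Submodule.span ℤ s)
  rw [rank_span_set hind, hs] at h1
  have h0 := Cardinal.eq_of_add_eq_add_right (h1.trans (zero_add _).symm) hA
  rw [rank_eq_zero_iff] at h0
  refine ⟨(hfin.preimage (Additive.ofMul.injective.injOn)).toFinset, fun x => ?_⟩
  obtain ⟨r, hr, hx⟩ := h0 (Submodule.Quotient.mk (Additive.ofMul x))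
  rw [← Submodule.Quotient.mk_smul, Submodule.Quotient.mk_eq_zero] at hx
  have hmem : x ^ r ∈ Subgroup.closure (Additive.ofMul ⁻¹' s) := by
    rw [← Submodule.mem_toAddSubgroup, Submodule.span_int_eq_addSubgroupClosure] at hx
    have : Additive.ofMul (x ^ r) ∈ (Subgroup.closure (Additive.ofMul ⁻¹' s)).toAddSubgroup := by
      rw [Subgroup.toAddSubgroup_closure]
      exact hx
    exact this
  refine ⟨r.natAbs, Int.natAbs_pos.2 hr, ?_⟩
  rw [Set.Finite.coe_toFinset]
  rcases Int.natAbs_eq r with h | h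
  · rw [h, zpow_natCast] at hmem
    exact hmem
  · rw [h, zpow_neg, zpow_natCast, inv_mem_iff] at hmem
    exact hmem

theorem exists_pow_eq_of_mem_divHull {Ω : Type*} [Field Ω] [IsAlgClosed Ω] (Γ : Subgroup Ωˣ)
    {d : Ωˣ} (hd : d ∈ divHull Γ) {n : ℕ} (hn : 0 < n) : ∃ e ∈ divHull Γ, e ^ n = d := by
  obtain ⟨e, he⟩ := IsAlgClosed.exists_pow_nat_eq (d : Ω) hn
  have he0 : e ≠ 0 := by
    rintro rfl
    rw [zero_pow hn.ne'] at he
    exact d.ne_zero he.symm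
  obtain ⟨m, hm, hdm⟩ := hd
  have hed : Units.mk0 e he0 ^ n = d := Units.ext he
  exact ⟨Units.mk0 e he0, ⟨n * m, Nat.mul_pos hn hm, by rwa [pow_mul, hed]⟩, hed⟩

theorem mem_divHull_of_pow_mem {G : Type*} [CommGroup G] {Γ : Subgroup G} {x : G} {n : ℕ}
    (hn : 0 < n) (hx : x ^ n ∈ divHull Γ) : x ∈ divHull Γ := by
  obtain ⟨m, hm, h⟩ := hx
  exact ⟨n * m, Nat.mul_pos hn hm, by rwa [pow_mul]⟩

/-- A finite extension of `F(S)` is contained in `K[S]` for every field `K` containing a suitable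
finite set. -/
theorem exists_finset_forall_mem_adjoin {F Ω : Type*} [Field F] [Field Ω] [Algebra F Ω]
    [Algebra.IsAlgebraic F Ω] (S : Set Ω)
    (L : IntermediateField (IntermediateField.adjoin F S) Ω)
    (hL : FiniteDimensional (IntermediateField.adjoin F S) L) :
    ∃ t : Finset Ω, ∀ K : IntermediateField F Ω, (t : Set Ω) ⊆ K → ∀ x ∈ L,
      x ∈ Algebra.adjoin K S := by
  classical
  let b := Module.finBasis (IntermediateField.adjoin F S) L
  refine ⟨Finset.univ.image fun i => (b i : Ω), fun K hK x hx => ?_⟩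
  -- As `S` is algebraic over `F`, the ring `F[S]` is already the field `F(S)`.
  have hF (f : IntermediateField.adjoin F S) : (f : Ω) ∈ Algebra.adjoin K S := by
    have h1 : (f : Ω) ∈ Algebra.adjoin F S := by
      rw [← IntermediateField.adjoin_toSubalgebra]
      exact f.2
    have h2 : Algebra.adjoin F S ≤ (Algebra.adjoin K S).restrictScalars F :=
      Algebra.adjoin_le Algebra.subset_adjoin
    exact h2 h1
  have hsum := congrArg (algebraMap L Ω) (b.sum_repr ⟨x, hx⟩)
  rw [map_sum] at hsum
  change _ = x at hsum
  rw [← hsum]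
  refine sum_mem fun i _ => ?_
  rw [Algebra.smul_def, map_mul]
  refine mul_mem (hF _) ?_
  exact (Algebra.adjoin K S).algebraMap_mem ⟨b i, hK (by simp)⟩

theorem NumberField.pow_torsionOrder_eq_one {K : Type*} [Field K] [NumberField K] {ζ : K} {k : ℕ}
    (hk : 0 < k) (hζ : ζ ^ k = 1) : ζ ^ NumberField.Units.torsionOrder K = 1 := by
  let z : NumberField.RingOfIntegers K := ⟨ζ, IsIntegral.of_pow hk (hζ ▸ isIntegral_one)⟩
  have hz : z ^ k = 1 := NumberField.RingOfIntegers.ext hζ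
  let u := Units.ofPowEqOne z k hz hk.ne'
  have hu : u ∈ NumberField.Units.torsion K :=
    (CommGroup.mem_torsion _).2 (isOfFinOrder_iff_pow_eq_one.2 ⟨k, hk, Units.ext hz⟩)
  rw [← NumberField.Units.rootsOfUnity_eq_torsion, mem_rootsOfUnity] at hu
  have h := congrArg (fun v : (NumberField.RingOfIntegers K)ˣ => (v : K)) hu
  rw [Units.val_pow_eq_pow_val, Units.val_one, map_pow, map_one] at h
  exact h

theorem isTorsionFree_additive_quotient {G : Type*} [CommGroup G] {P : Subgroup G}
    (hP : ∀ (x : G) (n : ℕ), 0 < n → x ^ n ∈ P → x ∈ P) :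
    Module.IsTorsionFree ℤ (Additive (G ⧸ P)) := by
  refine Module.IsTorsionFree.of_smul_eq_zero fun r p h => or_iff_not_imp_left.2 fun hr => ?_
  obtain ⟨x, hx⟩ : ∃ x : G, Additive.ofMul (QuotientGroup.mk x) = p :=
    QuotientGroup.mk_surjective p.toMul
  have h' : r.natAbs • p = 0 := by
    rcases Int.natAbs_eq r with h0 | h0
    · rwa [h0, natCast_zsmul] at h
    · rwa [h0, neg_smul, natCast_zsmul, neg_eq_zero] at h
  rw [← hx] at h' ⊢
  exact (QuotientGroup.eq_one_iff x).2
    (hP x _ (Int.natAbs_pos.2 hr) ((QuotientGroup.eq_one_iff (x ^ r.natAbs)).1 h'))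

/-! ### Freeness of the quotient -/

/-- If all the elements of `G ≤ Ωˣ` lie in `K[Γ_div]` for every sufficiently large number field `K`,
then `G / (G ∩ Γ_div)` is free abelian. -/
theorem isFreeAbelian_quotient_comap_divHull {Ω : Type*} [Field Ω] [Algebra ℚ Ω]
    [Algebra.IsAlgebraic ℚ Ω] [IsAlgClosed Ω]
    {Γ : Subgroup Ωˣ} (hΓ : HasFiniteRank Γ) {G : Type*} [CommGroup G] {j : G →* Ωˣ}
    (hj : Function.Injective j) (t : Finset Ω)
    (ht : ∀ K : IntermediateField ℚ Ω, (t : Set Ω) ⊆ K → ∀ x : G,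
      (j x : Ω) ∈ Algebra.adjoin K (Units.val '' (divHull Γ : Set Ωˣ))) :
    IsFreeAbelian (G ⧸ (divHull Γ).comap j) := by
  have : CharZero Ω := algebraRat.charZero Ω
  have : IsAlgClosure ℚ Ω := ⟨inferInstance, inferInstance⟩
  have : Normal ℚ Ω := IsAlgClosure.normal ℚ Ω
  have : IsGalois ℚ Ω := ⟨⟩
  have htf : Module.IsTorsionFree ℤ (Additive (G ⧸ (divHull Γ).comap j)) :=
    isTorsionFree_additive_quotient fun x n hn hx =>
      mem_divHull_of_pow_mem hn (by simpa using hx)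
  have : Countable Ω := by
    have := Algebraic.countable ℚ Ω
    rw [← Set.countable_univ_iff]
    exact this.mono fun x _ => Algebra.IsAlgebraic.isAlgebraic x
  have : Countable Ωˣ := Units.val_injective.countable
  have : Countable G := hj.countable
  have : Countable (Additive (G ⧸ (divHull Γ).comap j)) :=
    (QuotientGroup.mk_surjective (s := (divHull Γ).comap j)).countable
  refine Module.free_of_countable_of_saturation_fg fun N hN => ?_
  obtain ⟨g, rfl⟩ := hN
  obtain ⟨s, hs⟩ := exists_finset_pow_mem_closure_of_hasFiniteRank hΓ
  have hrep (p : Additive (G ⧸ (divHull Γ).comap j)) :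
      ∃ x : G, Additive.ofMul (QuotientGroup.mk x) = p := QuotientGroup.mk_surjective p.toMul
  choose rep hrep using hrep
  let U : Set Ωˣ :=
    Subtype.val '' (s : Set Γ) ∪ (fun p => j (rep p)) '' (g : Set (Additive (G ⧸ (divHull Γ).comap j)))
  have hU : U.Finite := (s.finite_toSet.image _).union (g.finite_toSet.image _)
  let K : IntermediateField ℚ Ω :=
    IntermediateField.adjoin ℚ ((t : Set Ω) ∪ Units.val '' U)
  have : FiniteDimensional ℚ K :=
    have := (t.finite_toSet.union (hU.image Units.val)).to_subtype
    IntermediateField.finiteDimensional_adjoin fun x _ => Algebra.IsIntegral.isIntegral x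
  have : NumberField K :=
    { to_charZero := inferInstance
      to_finiteDimensional := by
        convert! this
        exact Subsingleton.elim _ _ }
  have hKt : (t : Set Ω) ⊆ K :=
    Set.subset_union_left.trans (IntermediateField.subset_adjoin ℚ _)
  have hKU {u : Ωˣ} (hu : u ∈ U) : (u : Ω) ∈ K :=
    IntermediateField.subset_adjoin ℚ _ (Or.inr ⟨u, hu, rfl⟩)
  let i : Kˣ →* Ωˣ :=
    Units.map (algebraMap K Ω : K →* Ω)
  have hi : Function.Injective i := Units.map_injective (algebraMap K _).injective
  let H : Subgroup Kˣ := Subgroup.closure (i ⁻¹' U)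
  have hHU : H.map i = Subgroup.closure U := by
    rw [MonoidHom.map_closure, Set.image_preimage_eq_of_subset]
    intro u hu
    exact ⟨Units.mk0 ⟨u, hKU hu⟩ fun h => u.ne_zero (congrArg Subtype.val h), Units.ext rfl⟩
  let M : Submodule ℤ (Additive Kˣ) := AddSubgroup.toIntSubmodule H.toAddSubgroup
  have hM : M.FG := by
    rw [Submodule.fg_iff_addSubgroup_fg]
    refine (Subgroup.fg_iff_add_fg H).1 ⟨(hU.preimage hi.injOn).toFinset, ?_⟩
    rw [Set.Finite.coe_toFinset]
  have hMsat := NumberField.saturation_fg hM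
  have hD (d) (hd : d ∈ divHull Γ) : ∃ n : ℕ, 0 < n ∧ d ^ n ∈ H.map i := by
    obtain ⟨m, hm, hdm⟩ := hd
    obtain ⟨n, hn, h⟩ := hs ⟨d ^ m, hdm⟩
    refine ⟨m * n, Nat.mul_pos hm hn, ?_⟩
    have h1 := Subgroup.mem_map_of_mem Γ.subtype h
    rw [MonoidHom.map_closure] at h1
    rw [hHU, pow_mul]
    exact Subgroup.closure_mono Set.subset_union_left h1
  let w := NumberField.Units.torsionOrder K
  let q : Additive Kˣ →ₗ[ℤ] Additive (Ωˣ ⧸ divHull Γ) :=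
    (MonoidHom.toAdditive ((QuotientGroup.mk' (divHull Γ)).comp i)).toIntLinearMap
  let φ : Additive (G ⧸ (divHull Γ).comap j) →ₗ[ℤ] Additive (Ωˣ ⧸ divHull Γ) :=
    (MonoidHom.toAdditive (QuotientGroup.map ((divHull Γ).comap j) (divHull Γ) j le_rfl)).toIntLinearMap
  have hφinj : Function.Injective φ := by
    refine (injective_iff_map_eq_zero φ).2 fun p hp => ?_
    obtain ⟨x, hx⟩ : ∃ x : G, Additive.ofMul (QuotientGroup.mk x) = p :=
      QuotientGroup.mk_surjective p.toMul
    rw [← hx] at hp ⊢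
    exact (QuotientGroup.eq_one_iff x).2 ((QuotientGroup.eq_one_iff (j x)).1 hp)
  have hφ (p) : φ p = Additive.ofMul (QuotientGroup.mk (j (rep p))) := by
    conv_lhs => rw [← hrep p]
    rfl
  have hspan : Submodule.span ℤ (g : Set (Additive (G ⧸ (divHull Γ).comap j))) ≤
      (M.map q).comap φ := by
    refine Submodule.span_le.2 fun p hp => ?_
    have h1 : j (rep p) ∈ H.map i := by
      rw [hHU]
      exact Subgroup.subset_closure (Or.inr ⟨p, hp, rfl⟩)
    obtain ⟨h, hh, hhp⟩ := h1
    refine ⟨Additive.ofMul h, hh, ?_⟩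
    rw [hφ, ← hhp]
    rfl
  -- The exponent `w` depends only on `K`, hence serves all of the saturation at once.
  have hsat : (Submodule.span ℤ (g : Set (Additive (G ⧸ (divHull Γ).comap j)))).saturation ≤
      (M.saturation.map q).comap ((w : ℤ) • φ) := by
    rintro p ⟨r, hr, hp⟩
    have hp' : r.natAbs • p ∈ Submodule.span ℤ (g : Set (Additive (G ⧸ (divHull Γ).comap j))) := by
      rcases Int.natAbs_eq r with h | h
      · rwa [h, natCast_zsmul] at hp
      · rwa [h, neg_smul, natCast_zsmul, Submodule.neg_mem_iff] at hp
    obtain ⟨h, hh, hhp⟩ := hspan hp'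
    rw [map_nsmul, hφ] at hhp
    obtain ⟨b, ⟨m, hm, hbm⟩, hb⟩ := exists_pow_div_mem_of_pow_mem (Ω := Ω) (w := w)
      (fun ζ k hk hζ => NumberField.pow_torsionOrder_eq_one hk hζ)
      (D := divHull Γ) (H := H)
      (fun d hd n hn => exists_pow_eq_of_mem_divHull Γ hd hn)
      (fun ζ k hk hζ => ⟨k, hk, hζ ▸ Γ.one_mem⟩) hD (x := j (rep p))
      (ht K hKt (rep p)) (Int.natAbs_pos.2 hr)
      ⟨h.toMul, hh, QuotientGroup.eq_iff_div_mem.1 hhp.symm⟩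
    refine ⟨Additive.ofMul b, ⟨m, by exact_mod_cast hm.ne', ?_⟩, ?_⟩
    · rw [natCast_zsmul]
      exact hbm
    · rw [LinearMap.smul_apply, natCast_zsmul, hφ]
      exact (QuotientGroup.eq_iff_div_mem.2 hb).symm
  have hwinj : Function.Injective ((w : ℤ) • φ) := by
    refine (injective_iff_map_eq_zero _).2 fun p hp => ?_
    rw [LinearMap.smul_apply, ← map_smul, map_eq_zero_iff φ hφinj] at hp
    exact (smul_eq_zero.1 hp).resolve_left
      (Nat.cast_ne_zero.2 (NumberField.Units.torsionOrder_ne_zero K))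
  have : IsNoetherian ℤ (M.saturation.map q) :=
    have : Module.Finite ℤ (M.saturation.map q) := Module.Finite.iff_fg.2 (hMsat.map q)
    inferInstance
  refine Submodule.fg_of_fg_map_injective _ hwinj ?_
  exact Submodule.FG.of_le_of_isNoetherian (Submodule.map_le_iff_le_comap.2 hsat)

theorem theorem1p2 (Γ : Subgroup (AlgebraicClosure ℚ)ˣ) (hΓ : HasFiniteRank Γ)
    (L : IntermediateField (fieldOfDivHull Γ) (AlgebraicClosure ℚ))
    (hL : FiniteDimensional (fieldOfDivHull Γ) L) :
    IsFreeAbelian (Lˣ ⧸ divHullIn Γ L) := by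
  -- The two `ℚ`-algebra structures on the closure agree.
  have : Algebra.IsAlgebraic ℚ (AlgebraicClosure ℚ) := by
    rw [show (DivisionRing.toRatAlgebra : Algebra ℚ (AlgebraicClosure ℚ)) =
      AlgebraicClosure.instAlgebra ℚ from Subsingleton.elim _ _]
    exact AlgebraicClosure.isAlgebraic ℚ
  obtain ⟨t, ht⟩ := exists_finset_forall_mem_adjoin (F := ℚ)
    (Units.val '' (divHull Γ : Set (AlgebraicClosure ℚ)ˣ)) L hL
  exact isFreeAbelian_quotient_comap_divHull hΓ
    (Units.map_injective (algebraMap L (AlgebraicClosure ℚ)).injective) t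
    fun K hK x => ht K hK x x.1.2
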